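/- Let $\mathcal{Y}=(\Omega,\{R_0,R_1,\ldots,R_r\})$ be a (commutative) association scheme with $r$ classes, $R_0$ being the identity relation, with intersection numbers $p_{ij}^k$ and valencies $k_i$ (the number of $z$ with $(x,z)\in R_i$). Assume that $\mathcal{Y}$ is amorphic, i.e. it is symmetric and each of its fusions is an association scheme, and that it is pseudocyclic, i.e. $k_1=\cdots=k_r$; if $r=2$, assume moreover that the multiplicities of $\mathcal{Y}$, i.e. the ranks of the primitive idempotents of its Bose--Mesner algebra other than $\frac1{|\Omega|}\mathsf{J}$, are equal. Let $G$ be an elementary abelian $2$-group of order $r$ (the trivial group being allowed if $r=1$). Then for every labelling (bijection) of the non-diagonal relations of $\mathcal{Y}$ by the elements of $G$, written $R_g$ $(g\in G)$, the following hold. (i) $R_g^\top=R_{g^{-1}}$ for all $g\in G$, and \[ \sum_{g\in G} p_{g^{-1},gh}^m = k_{h^{-1}m}-\delta_{h,1}\qquad\text{for all } h,m\in G. \] (ii) Let $\mathsf{A}_g$ be the adjacency matrix of $R_g$, and put \[ \widetilde{\mathsf{A}}_1=\begin{bmatrix}0&\mathbf{1}\\ \mathbf{1}^\top&\mathsf{A}_1\end{bmatrix},\qquad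 \widetilde{\mathsf{A}}_g=\begin{bmatrix}0&0\\ 0&\mathsf{A}_g\end{bmatrix}\quad(g\in G\setminus\{1\}). \] Then $\mathsf{B}=\sum_{g\in G} g\,\widetilde{\mathsf{A}}_g$ is a roux matrix for $G$: it is a square matrix over $\mathbb{C}[G]$ with zero diagonal, its off-diagonal entries lie in $G$ and satisfy $\mathsf{B}_{ji}=(\mathsf{B}_{ij})^{-1}$, and the matrices $g\mathsf{I}$ and $g\mathsf{B}$ $(g\in G)$ span a $\mathbb{C}$-algebra. -/

import Mathlib

open scoped BigOperators

/-- A commutative association scheme of `d` classes on a finite set `Ω`, with relations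
`R_0, …, R_d`. The data `tr` (index of the transposed relation) and `p` (intersection numbers,
`p i j k` standing for `p_{ij}^k`) are determined by the relations, since these are nonempty and
pairwise disjoint. -/
structure AssociationScheme (Ω : Type*) [Fintype Ω] (d : ℕ) where
  rel : Fin (d + 1) → Ω → Ω → Prop
  rel_zero : ∀ x y, rel 0 x y ↔ x = y
  rel_nonempty : ∀ i, ∃ x y, rel i x y
  rel_existsUnique : ∀ x y, ∃! i, rel i x y
  tr : Fin (d + 1) → Fin (d + 1)
  rel_tr : ∀ j x y, rel (tr j) x y ↔ rel j y x
  p : Fin (d + 1) → Fin (d + 1) → Fin (d + 1) → ℕ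
  ncard_eq_p : ∀ i j k x y, rel k x y → {z | rel i x z ∧ rel j z y}.ncard = p i j k
  p_comm : ∀ i j k, p i j k = p j i k

namespace AssociationScheme

variable {Ω : Type*} [Fintype Ω] {d : ℕ}

/-- Every relation equals its transpose. -/
def IsSymmetric (X : AssociationScheme Ω d) : Prop :=
  ∀ j x y, X.rel j x y ↔ X.rel j y x

/-- The valency `k_i = p_{i i'}^0` of `R_i`, where `R_{i'}` is the transpose of `R_i`: the number
of `z` with `(x, z) ∈ R_i`, for any `x`. In a symmetric scheme this is `p_{ii}^0`. -/
def valency (X : AssociationScheme Ω d) (i : Fin (d + 1)) : ℕ :=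
  X.p i (X.tr i) 0

/-- All nondiagonal relations have the same valency. -/
def IsPseudocyclic (X : AssociationScheme Ω d) : Prop :=
  ∀ i j, i ≠ 0 → j ≠ 0 → X.valency i = X.valency j

/-- A symmetric scheme all of whose fusions are association schemes. A fusion merges the
relations along a surjection of the index sets under which `0` is the only index sent to `0`. -/
def IsAmorphic (X : AssociationScheme Ω d) : Prop :=
  X.IsSymmetric ∧
    ∀ (e : ℕ) (f : Fin (d + 1) → Fin (e + 1)), Function.Surjective f → (∀ i, f i = 0 ↔ i = 0) →
      ∃ Y : AssociationScheme Ω e, ∀ j x y, Y.rel j x y ↔ ∃ i, f i = j ∧ X.rel i x y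

open Classical in
/-- The adjacency matrix of `R_i`. -/
noncomputable def adj (X : AssociationScheme Ω d) (i : Fin (d + 1)) : Matrix Ω Ω ℂ :=
  Matrix.of fun x y => if X.rel i x y then 1 else 0

/-- The Bose-Mesner algebra, as a space of matrices. -/
noncomputable def boseMesner (X : AssociationScheme Ω d) : Submodule ℂ (Matrix Ω Ω ℂ) :=
  Submodule.span ℂ (Set.range X.adj)

/-- `E` is a primitive idempotent of the Bose-Mesner algebra. -/
structure IsPrimitiveIdempotent (X : AssociationScheme Ω d) (E : Matrix Ω Ω ℂ) : Prop where
  mem : E ∈ X.boseMesner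
  idem : E * E = E
  ne_zero : E ≠ 0
  minimal : ∀ F ∈ X.boseMesner, F * F = F → E * F = F → F = 0 ∨ F = E

/-- All multiplicities (ranks of primitive idempotents), except the one of the trivial primitive
idempotent `J / |Ω|`, are equal. -/
def HasEqualMultiplicities (X : AssociationScheme Ω d) : Prop :=
  ∀ E F : Matrix Ω Ω ℂ, X.IsPrimitiveIdempotent E → X.IsPrimitiveIdempotent F →
    E ≠ (Fintype.card Ω : ℂ)⁻¹ • Matrix.of (fun _ _ => 1) →
    F ≠ (Fintype.card Ω : ℂ)⁻¹ • Matrix.of (fun _ _ => 1) →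
    E.rank = F.rank

/-- A labelling of the nondiagonal relations by the elements of `G`, `R_g` having
index `σ g`. -/
abbrev Labelling (G : Type*) (d : ℕ) : Type _ := G ≃ {i : Fin (d + 1) // i ≠ 0}

/-- The two conditions on a labelled scheme: `R_g` is the transpose of the relation labelled by
the inverse of `g`, and
`∑_g p_{g⁻¹, gh}^m = k_{h⁻¹ m} - δ_{h,1}` for all `h`, `m`. -/
structure RouxConditions {G : Type*} [CommGroup G] [Fintype G] [DecidableEq G]
    (X : AssociationScheme Ω d) (σ : Labelling G d) : Prop where
  transpose : ∀ g x y, X.rel (σ g) y x ↔ X.rel (σ g⁻¹) x y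
  intersection : ∀ h m : G,
    ∑ g : G, (X.p (σ g⁻¹) (σ (g * h)) (σ m) : ℤ)
      = (X.valency (σ (h⁻¹ * m)) : ℤ) - (if h = 1 then 1 else 0)

/-- The bordered adjacency matrices. -/
noncomputable def borderedAdj {G : Type*} [CommGroup G] [DecidableEq G]
    (X : AssociationScheme Ω d) (σ : Labelling G d) (g : G) : Matrix (Unit ⊕ Ω) (Unit ⊕ Ω) ℂ :=
  if g = 1 then
    Matrix.fromBlocks 0 (Matrix.of fun _ _ => 1) (Matrix.of fun _ _ => 1) (X.adj (σ g))
  else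
    Matrix.fromBlocks 0 0 0 (X.adj (σ g))

/-- The matrix `B = ∑_g g Ã_g` over `ℂ[G]`, where `Ã_g` is the bordered adjacency matrix. -/
noncomputable def rouxCandidate {G : Type*} [CommGroup G] [Fintype G] [DecidableEq G]
    (X : AssociationScheme Ω d) (σ : Labelling G d) :
    Matrix (Unit ⊕ Ω) (Unit ⊕ Ω) (MonoidAlgebra ℂ G) :=
  ∑ g : G, MonoidAlgebra.of ℂ G g •
    (X.borderedAdj σ g).map (algebraMap ℂ (MonoidAlgebra ℂ G))

end AssociationScheme

/-- Roux matrices for an abelian group `G`. -/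
structure IsRouxMatrix {G ι : Type*} [CommGroup G] [Fintype ι] [DecidableEq ι]
    (B : Matrix ι ι (MonoidAlgebra ℂ G)) : Prop where
  diag : ∀ i, B i i = 0
  offDiag : ∀ i j, i ≠ j → ∃ g : G, B i j = MonoidAlgebra.of ℂ G g
  inv : ∀ i j, i ≠ j → ∀ g : G, B i j = MonoidAlgebra.of ℂ G g → B j i = MonoidAlgebra.of ℂ G g⁻¹
  span_algebra : ∃ S : Subalgebra ℂ (Matrix ι ι (MonoidAlgebra ℂ G)),
    Subalgebra.toSubmodule S = Submodule.span ℂ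
      (Set.range (fun g : G => MonoidAlgebra.of ℂ G g • (1 : Matrix ι ι (MonoidAlgebra ℂ G))) ∪
        Set.range (fun g : G => MonoidAlgebra.of ℂ G g • B))

/-! Everything follows from uniformity (`IsUniform`): for distinct nonzero indices, `p i i j` is one
constant μ and `p i j l` one constant c. Once this is known, the labelling cannot matter. Fusing
{i}, then {i, j}, against the remaining relations shows that `p i i l` and `p i j l` do not depend
on the outside index l (`IsAmorphic.sum_p_eq`). Equal valencies make `p` symmetric in its nonzero
indices (`IsPseudocyclic.p_swap`), which yields c; row sums compared through a third index then
yield μ (`IsAmorphic.isUniform`). With two classes there is no third index, and equal multiplicities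
force the eigenvalues of `adj 1` off the all-ones vector to sum to -1 (`IsSymmetric.isUniform_two`).
Given uniformity, the sum in (i) agrees term by term with a row sum of intersection numbers.
Condition (i) is in turn what gives B² = |Ω| I + k (∑ g) B, with k the common valency, and this
makes the span closed under products. -/

namespace AssociationScheme

/-! ### Intersection numbers of symmetric schemes and of fusions -/

section Basic

variable {Ω : Type*} [Fintype Ω] {d : ℕ}

/-- The index of the relation containing `(x, y)`. -/
noncomputable def idx (X : AssociationScheme Ω d) (x y : Ω) : Fin (d + 1) :=
  (X.rel_existsUnique x y).choose

lemma rel_iff_idx (X : AssociationScheme Ω d) {i : Fin (d + 1)} {x y : Ω} :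
    X.rel i x y ↔ X.idx x y = i :=
  ⟨fun h => ((X.rel_existsUnique x y).choose_spec.2 i h).symm,
    fun h => h ▸ (X.rel_existsUnique x y).choose_spec.1⟩

lemma idx_eq_zero (X : AssociationScheme Ω d) {x y : Ω} : X.idx x y = 0 ↔ x = y := by
  rw [← rel_iff_idx, X.rel_zero]

lemma idx_self (X : AssociationScheme Ω d) (x : Ω) : X.idx x x = 0 :=
  X.idx_eq_zero.2 rfl

lemma exists_idx (X : AssociationScheme Ω d) (i : Fin (d + 1)) : ∃ x y, X.idx x y = i := by
  obtain ⟨x, y, h⟩ := X.rel_nonempty i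
  exact ⟨x, y, X.rel_iff_idx.1 h⟩

lemma card_eq_p (X : AssociationScheme Ω d) (i j : Fin (d + 1)) (x y : Ω) :
    (Finset.univ.filter fun z => X.idx x z = i ∧ X.idx z y = j).card = X.p i j (X.idx x y) := by
  classical
  rw [← X.ncard_eq_p i j _ x y (X.rel_iff_idx.2 rfl), ← Set.ncard_coe_finset]
  congr 1
  ext z
  simp [rel_iff_idx]

/-- Summing over the middle vertex amounts to summing against intersection numbers. -/
lemma sum_idx {M : Type*} [AddCommMonoid M] (X : AssociationScheme Ω d)
    (F : Fin (d + 1) → Fin (d + 1) → M) (x y : Ω) :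
    ∑ z, F (X.idx x z) (X.idx z y) = ∑ i, ∑ j, X.p i j (X.idx x y) • F i j := by
  classical
  rw [← Fintype.sum_prod_type' (f := fun i j => X.p i j (X.idx x y) • F i j),
    ← Finset.sum_fiberwise Finset.univ (fun z => (X.idx x z, X.idx z y))]
  refine Finset.sum_congr rfl fun ij _ => ?_
  rw [← X.card_eq_p, ← Finset.sum_const]
  have : (Finset.univ.filter fun z => (X.idx x z, X.idx z y) = ij)
      = Finset.univ.filter fun z => X.idx x z = ij.1 ∧ X.idx z y = ij.2 := by
    ext z; simp [Prod.ext_iff]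
  rw [this]
  refine Finset.sum_congr rfl fun z hz => ?_
  rw [Finset.mem_filter] at hz
  rw [hz.2.1, hz.2.2]

lemma IsSymmetric.idx_comm {X : AssociationScheme Ω d} (hX : X.IsSymmetric) (x y : Ω) :
    X.idx x y = X.idx y x := by
  rw [← rel_iff_idx, hX, rel_iff_idx]

lemma IsSymmetric.tr_eq {X : AssociationScheme Ω d} (hX : X.IsSymmetric) (i : Fin (d + 1)) :
    X.tr i = i := by
  obtain ⟨x, y, h⟩ := X.rel_nonempty i
  have h' := (X.rel_tr i x y).2 ((hX _ _ _).1 h)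
  rw [rel_iff_idx] at h h'
  exact h'.symm.trans h

lemma IsSymmetric.card_eq_valency {X : AssociationScheme Ω d} (hX : X.IsSymmetric)
    (i : Fin (d + 1)) (x : Ω) :
    (Finset.univ.filter fun z => X.idx x z = i).card = X.valency i := by
  have h := X.card_eq_p i i x x
  rw [X.idx_self] at h
  rw [valency, hX.tr_eq, ← h]
  congr 1
  ext z
  simp [hX.idx_comm z x]

lemma IsSymmetric.sum_idx_left {M : Type*} [AddCommMonoid M] {X : AssociationScheme Ω d}
    (hX : X.IsSymmetric) (f : Fin (d + 1) → M) (x : Ω) :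
    ∑ z, f (X.idx x z) = ∑ i, X.valency i • f i := by
  classical
  rw [← Finset.sum_fiberwise Finset.univ (fun z => X.idx x z)]
  refine Finset.sum_congr rfl fun i _ => ?_
  rw [← hX.card_eq_valency i x, ← Finset.sum_const]
  refine Finset.sum_congr rfl fun z hz => ?_
  rw [(Finset.mem_filter.1 hz).2]

lemma IsSymmetric.card_eq {X : AssociationScheme Ω d} (hX : X.IsSymmetric) :
    Fintype.card Ω = ∑ i, X.valency i := by
  obtain ⟨x, -, -⟩ := X.rel_nonempty 0
  have h := hX.sum_idx_left (fun _ => 1) x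
  simp only [smul_eq_mul, mul_one] at h
  rw [Fintype.card_eq_sum_ones, h]

lemma IsSymmetric.valency_zero {X : AssociationScheme Ω d} (hX : X.IsSymmetric) :
    X.valency 0 = 1 := by
  classical
  obtain ⟨x, -, -⟩ := X.rel_nonempty 0
  rw [← hX.card_eq_valency 0 x]
  simp only [idx_eq_zero]
  rw [Finset.card_eq_one]
  exact ⟨x, by ext; simp [eq_comm]⟩

lemma IsSymmetric.valency_pos {X : AssociationScheme Ω d} (hX : X.IsSymmetric)
    (i : Fin (d + 1)) : 0 < X.valency i := by
  obtain ⟨x, y, h⟩ := X.exists_idx i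
  rw [← hX.card_eq_valency i x]
  exact Finset.card_pos.2 ⟨y, by simp [h]⟩

lemma IsSymmetric.sum_p {X : AssociationScheme Ω d} (hX : X.IsSymmetric)
    (i k : Fin (d + 1)) : ∑ j, X.p j i k = X.valency i := by
  obtain ⟨x, y, rfl⟩ := X.exists_idx k
  have h := X.sum_idx (fun _ i' => if i' = i then 1 else 0) x y
  simp only [hX.idx_comm _ y] at h
  rw [hX.sum_idx_left (fun i' => if i' = i then 1 else 0) y] at h
  rw [hX.idx_comm x y]
  simpa using h.symm

lemma p_zero_left (X : AssociationScheme Ω d) (j k : Fin (d + 1)) :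
    X.p 0 j k = if j = k then 1 else 0 := by
  classical
  obtain ⟨x, y, rfl⟩ := X.exists_idx k
  rw [← X.card_eq_p]
  simp only [idx_eq_zero]
  split_ifs with h
  · rw [Finset.card_eq_one]
    refine ⟨x, ?_⟩
    ext z
    simp only [Finset.mem_filter, Finset.mem_univ, true_and, Finset.mem_singleton]
    constructor
    · rintro ⟨rfl, -⟩; rfl
    · rintro rfl; exact ⟨rfl, h.symm⟩
  · rw [Finset.card_eq_zero]
    ext z
    simp only [Finset.mem_filter, Finset.mem_univ, true_and, Finset.notMem_empty, iff_false]
    rintro ⟨rfl, h'⟩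
    exact h h'.symm

/-- Double counting: both sides count the pairs (y, z) that form with a fixed x a triangle whose
sides xy, xz, zy have types k, i, j. -/
lemma IsSymmetric.valency_mul_p {X : AssociationScheme Ω d} (hX : X.IsSymmetric)
    (i j k : Fin (d + 1)) : X.valency k * X.p i j k = X.valency i * X.p k j i := by
  obtain ⟨x, -, -⟩ := X.rel_nonempty 0
  have key : ∀ i k : Fin (d + 1),
      ∑ y, ∑ z, (if X.idx x y = k ∧ X.idx x z = i ∧ X.idx z y = j then 1 else 0)
        = X.valency k * X.p i j k := by
    intro i k
    have h1 : ∀ y, ∑ z, (if X.idx x y = k ∧ X.idx x z = i ∧ X.idx z y = j then 1 else 0)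
        = (if X.idx x y = k then X.p i j k else 0) := by
      intro y
      split_ifs with h
      · subst h
        simp [← X.card_eq_p]
      · simp [h]
    simp only [h1]
    rw [hX.sum_idx_left (fun l => if l = k then X.p i j k else 0) x]
    simp
  rw [← key i k, ← key k i, Finset.sum_comm]
  refine Finset.sum_congr rfl fun y _ => Finset.sum_congr rfl fun z _ => ?_
  rw [hX.idx_comm y z]
  congr 1
  exact propext ⟨fun ⟨a, b, c⟩ => ⟨b, a, c⟩, fun ⟨a, b, c⟩ => ⟨b, a, c⟩⟩

lemma IsPseudocyclic.p_swap {X : AssociationScheme Ω d} (hP : X.IsPseudocyclic)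
    (hX : X.IsSymmetric) {i k : Fin (d + 1)} (hi : i ≠ 0) (hk : k ≠ 0) (j : Fin (d + 1)) :
    X.p i j k = X.p k j i := by
  have h := hX.valency_mul_p i j k
  rw [hP k i hk hi] at h
  exact Nat.eq_of_mul_eq_mul_left (hX.valency_pos i) h

/-- Merging the relations indexed by `S` against all the others. -/
lemma IsAmorphic.sum_p_eq {X : AssociationScheme Ω d} (hX : X.IsAmorphic)
    (S : Finset (Fin (d + 1))) (h0 : (0 : Fin (d + 1)) ∉ S) (hS : S.Nonempty)
    {l m : Fin (d + 1)} (hl : l ≠ 0) (hm : m ≠ 0) (hlS : l ∉ S) (hmS : m ∉ S) :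
    ∑ i ∈ S, ∑ j ∈ S, X.p i j l = ∑ i ∈ S, ∑ j ∈ S, X.p i j m := by
  classical
  -- Both l and m land in class 2 of this fusion, so both sums equal its intersection number `Y.p 1
  -- 1 2`.
  set f : Fin (d + 1) → Fin (2 + 1) := fun i => if i = 0 then 0 else if i ∈ S then 1 else 2 with hf
  have hf1 : ∀ i, f i = 1 ↔ i ∈ S := by
    intro i
    simp only [hf]
    split_ifs with h h'
    · subst h; simpa using h0
    · simpa using h'
    · simpa using h'
  have hf2 : ∀ i, i ≠ 0 → i ∉ S → f i = 2 := fun i h h' => by simp [hf, h, h']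
  obtain ⟨Y, hY⟩ := hX.2 2 f (by
    intro j
    obtain ⟨s, hs⟩ := hS
    fin_cases j
    · exact ⟨0, by simp [hf]⟩
    · exact ⟨s, (hf1 s).2 hs⟩
    · exact ⟨l, hf2 l hl hlS⟩) (by
    intro i
    simp only [hf]
    split_ifs with h h' <;> simp [h])
  have hYX : ∀ x y, Y.idx x y = f (X.idx x y) := fun x y => by
    rw [← rel_iff_idx, hY]
    exact ⟨_, rfl, X.rel_iff_idx.2 rfl⟩
  have key : ∀ l, l ≠ 0 → l ∉ S → ∑ i ∈ S, ∑ j ∈ S, X.p i j l = Y.p 1 1 2 := by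
    intro l hl hlS
    obtain ⟨x, y, rfl⟩ := X.exists_idx l
    have h := X.sum_idx (fun i j => if i ∈ S then if j ∈ S then 1 else 0 else 0) x y
    have h' := Y.card_eq_p 1 1 x y
    rw [hYX, hf2 _ hl hlS] at h'
    rw [← h', Finset.card_filter]
    simp only [hYX, hf1, ite_and]
    rw [h]
    simp
  rw [key l hl hlS, key m hm hmS]

end Basic

/-! ### Amorphic pseudocyclic schemes are uniform -/

section Uniform

variable {Ω : Type*} [Fintype Ω] {d : ℕ}

/-- The intersection numbers `p i i j` and `p i j l` do not depend on the distinct nonzero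
indices `i`, `j`, `l`. -/
def IsUniform (X : AssociationScheme Ω d) : Prop :=
  ∃ μ c : ℕ, (∀ i j, i ≠ 0 → j ≠ 0 → i ≠ j → X.p i i j = μ) ∧
    ∀ i j l, i ≠ 0 → j ≠ 0 → l ≠ 0 → i ≠ j → i ≠ l → j ≠ l → X.p i j l = c

variable {X : AssociationScheme Ω d}

lemma IsAmorphic.p_self_eq (hX : X.IsAmorphic) {i j l : Fin (d + 1)} (hi : i ≠ 0) (hj : j ≠ 0)
    (hl : l ≠ 0) (hji : j ≠ i) (hli : l ≠ i) : X.p i i j = X.p i i l := by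
  simpa using hX.sum_p_eq {i} (by simpa using hi.symm) (by simp) hj hl (by simpa) (by simpa)

/-- Merging {i, j} controls the sum of four terms; the two square terms are already known to agree,
and the mixed terms are equal by commutativity. -/
lemma IsAmorphic.p_eq_third (hX : X.IsAmorphic) {i j l m : Fin (d + 1)} (hi : i ≠ 0)
    (hj : j ≠ 0) (hl : l ≠ 0) (hm : m ≠ 0) (hij : i ≠ j) (hli : l ≠ i) (hlj : l ≠ j)
    (hmi : m ≠ i) (hmj : m ≠ j) : X.p i j l = X.p i j m := by
  have h := hX.sum_p_eq {i, j} (by simp [hi.symm, hj.symm]) (by simp) hl hm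
    (by simp [hli, hlj]) (by simp [hmi, hmj])
  rw [Finset.sum_pair hij, Finset.sum_pair hij, Finset.sum_pair hij, Finset.sum_pair hij,
    Finset.sum_pair hij, Finset.sum_pair hij] at h
  have h1 := hX.p_self_eq hi hl hm hli hmi
  have h2 := hX.p_self_eq hj hl hm hlj hmj
  have h3 := X.p_comm j i l
  have h4 := X.p_comm j i m
  omega

/-- With i fixed, one may swap the last two indices or replace the last one. These moves connect all
pairs (j, l), in general via (j, l'), (l', j), (l', j'). -/
lemma IsAmorphic.p_eq_of_left (hX : X.IsAmorphic) (hP : X.IsPseudocyclic)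
    {i j l j' l' : Fin (d + 1)} (hi : i ≠ 0)
    (hj : j ≠ 0) (hl : l ≠ 0) (hj' : j' ≠ 0) (hl' : l' ≠ 0) (hij : i ≠ j) (hil : i ≠ l)
    (hjl : j ≠ l) (hij' : i ≠ j') (hil' : i ≠ l') (hjl' : j' ≠ l') :
    X.p i j l = X.p i j' l' := by
  have comm23 : ∀ {a b : Fin (d + 1)}, a ≠ 0 → b ≠ 0 → X.p i a b = X.p i b a := by
    intro a b ha hb
    rw [X.p_comm i a, hP.p_swap hX.1 ha hb, X.p_comm b]
  by_cases h : j = l'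
  · subst h
    rw [comm23 hj hl, comm23 hj' hj, comm23 hl hj]
    exact hX.p_eq_third hi hj hl hj' hij hil.symm hjl.symm hij'.symm hjl'
  · rw [hX.p_eq_third hi hj hl hl' hij hil.symm hjl.symm hil'.symm (Ne.symm h), comm23 hj hl',
      hX.p_eq_third hi hl' hj hj' hil' hij.symm h hij'.symm hjl', comm23 hl' hj']

lemma IsAmorphic.p_eq_of_distinct (hX : X.IsAmorphic) (hP : X.IsPseudocyclic)
    {i j l i' j' l' : Fin (d + 1)} (hi : i ≠ 0) (hj : j ≠ 0) (hl : l ≠ 0) (hi' : i' ≠ 0)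
    (hj' : j' ≠ 0) (hl' : l' ≠ 0) (hij : i ≠ j) (hil : i ≠ l) (hjl : j ≠ l) (hij' : i' ≠ j')
    (hil' : i' ≠ l') (hjl' : j' ≠ l') : X.p i j l = X.p i' j' l' := by
  by_cases h : i = i'
  · subst h
    exact hX.p_eq_of_left hP hi hj hl hj' hl' hij hil hjl hij' hil' hjl'
  -- The passage from i to i' goes through the triples (i, i', m) and (i', i, m). At least one of j,
  -- l differs from i' and serves as m.
  · have key : ∀ m, m ≠ 0 → m ≠ i → m ≠ i' → X.p i j l = X.p i' j' l' := by
      intro m hm hmi hmi'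
      rw [hX.p_eq_of_left hP hi hj hl hi' hm hij hil hjl h hmi.symm hmi'.symm, X.p_comm,
        hX.p_eq_of_left hP hi' hi hm hj' hl' (Ne.symm h) hmi'.symm hmi.symm hij' hil' hjl']
    by_cases hji : j = i'
    · exact key l hl hil.symm (hji ▸ hjl.symm)
    · exact key j hj hij.symm hji

/-- The case d = 2 is delegated to `h2`: the argument needs a third nonzero index besides any two
given ones. -/
lemma IsAmorphic.isUniform (hX : X.IsAmorphic) (hP : X.IsPseudocyclic)
    (h2 : d = 2 → X.IsUniform) : X.IsUniform := by
  classical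
  by_cases hd : d = 2
  · exact h2 hd
  obtain ⟨c, hc⟩ : ∃ c : ℕ, ∀ i j l, i ≠ 0 → j ≠ 0 → l ≠ 0 → i ≠ j → i ≠ l → j ≠ l →
      X.p i j l = c := by
    by_cases h : ∃ i j l : Fin (d + 1), i ≠ 0 ∧ j ≠ 0 ∧ l ≠ 0 ∧ i ≠ j ∧ i ≠ l ∧ j ≠ l
    · obtain ⟨i, j, l, hi, hj, hl, hij, hil, hjl⟩ := h
      exact ⟨X.p i j l, fun i' j' l' hi' hj' hl' hij' hil' hjl' =>
        hX.p_eq_of_distinct hP hi' hj' hl' hi hj hl hij' hil' hjl' hij hil hjl⟩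
    · exact ⟨0, fun i j l hi hj hl hij hil hjl =>
        (h ⟨i, j, l, hi, hj, hl, hij, hil, hjl⟩).elim⟩
  obtain ⟨μ, hμ⟩ : ∃ μ : Fin (d + 1) → ℕ, ∀ i j, i ≠ 0 → j ≠ 0 → i ≠ j → X.p i i j = μ i := by
    have : ∀ i, ∃ m, ∀ j, i ≠ 0 → j ≠ 0 → i ≠ j → X.p i i j = m := by
      intro i
      by_cases h : ∃ j, j ≠ 0 ∧ i ≠ j
      · obtain ⟨j, hj, hij⟩ := h
        exact ⟨_, fun l hi hl hil => hX.p_self_eq hi hl hj hil.symm hij.symm⟩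
      · exact ⟨0, fun j _ hj hij => (h ⟨j, hj, hij⟩).elim⟩
    choose μ hμ using this
    exact ⟨μ, hμ⟩
  -- Row sum of `p g i j` over g: the generic term is c, with corrections at g = 0, i, j.
  have hsum : ∀ i j, i ≠ 0 → j ≠ 0 → i ≠ j →
      (X.valency i : ℤ) = d * c + (μ i - c) + (μ j - c) := by
    intro i j hi hj hij
    rw [← hX.1.sum_p i j, Nat.cast_sum]
    have hpt : ∀ g : Fin (d + 1), (X.p g i j : ℤ) = c + (if g = 0 then -(c : ℤ) else 0)
        + (if g = i then (μ i : ℤ) - c else 0) + (if g = j then (μ j : ℤ) - c else 0) := by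
      intro g
      by_cases h0 : g = 0
      · subst h0
        simp [X.p_zero_left, hi.symm, hj.symm, hij]
      by_cases h1 : g = i
      · subst h1
        simp [h0, hij, hμ g j h0 hj hij]
      by_cases h2 : g = j
      · subst h2
        have : X.p g i g = μ g := by
          rw [X.p_comm, hP.p_swap hX.1 hi h0, hμ g i h0 hi h1]
        simp [h0, h1, this]
      · simp [h0, h1, h2, hc g i j h0 hi hj h1 h2 hij]
    rw [Finset.sum_congr rfl fun g _ => hpt g]
    simp only [Finset.sum_add_distrib, Finset.sum_const, Finset.sum_ite_eq', Finset.mem_univ,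
      if_true, Finset.card_univ, Fintype.card_fin, nsmul_eq_mul]
    push_cast
    ring
  have hconst : ∀ i j, i ≠ 0 → j ≠ 0 → i ≠ j → μ i = μ j := by
    intro i j hi hj hij
    -- Comparing `hsum` for (i, l) and (j, l) cancels everything except μ i and μ j.
    obtain ⟨l, hl⟩ : ∃ l : Fin (d + 1), l ∉ ({0, i, j} : Finset (Fin (d + 1))) := by
      by_contra! hall
      have h3 : ({0, i, j} : Finset (Fin (d + 1))).card = 3 :=
        Finset.card_eq_three.2 ⟨0, i, j, hi.symm, hj.symm, hij, rfl⟩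
      rw [Finset.eq_univ_iff_forall.2 hall, Finset.card_univ, Fintype.card_fin] at h3
      omega
    simp only [Finset.mem_insert, Finset.mem_singleton, not_or] at hl
    have h1 := hsum i l hi hl.1 (Ne.symm hl.2.1)
    have h2 := hsum j l hj hl.1 (Ne.symm hl.2.2)
    rw [hP i j hi hj] at h1
    omega
  by_cases h : ∃ i : Fin (d + 1), i ≠ 0
  · obtain ⟨i₀, hi₀⟩ := h
    refine ⟨μ i₀, c, fun i j hi hj hij => ?_, hc⟩
    rw [hμ i j hi hj hij]
    by_cases h : i = i₀
    · rw [h]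
    · exact hconst i i₀ hi hi₀ h
  · exact ⟨0, c, fun i _ hi => (h ⟨i, hi⟩).elim, hc⟩

/-! ### Uniformity gives condition (i) for every labelling -/

section Labelled

/-- A sum over all indices splits off the index `0`; the others are indexed by a labelling. -/
lemma sum_index_eq {G M : Type*} [Fintype G] [AddCommMonoid M] (σ : Labelling G d) (f : Fin (d + 1) → M) :
    ∑ i, f i = f 0 + ∑ g, f (σ g) := by
  classical
  rw [← Finset.add_sum_erase _ f (Finset.mem_univ 0)]
  congr 1
  rw [Equiv.sum_comp σ (fun i => f i)]
  symm
  exact (Finset.sum_subtype _ (by simp) f).symm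

variable {G : Type*} [CommGroup G] [Fintype G] [DecidableEq G]

lemma IsUniform.rouxConditions (hU : X.IsUniform) (hS : X.IsSymmetric) (hP : X.IsPseudocyclic)
    (helem : ∀ g : G, g ^ 2 = 1) (σ : Labelling G d) : X.RouxConditions σ := by
  have hinv : ∀ g : G, g⁻¹ = g := fun g =>
    inv_eq_of_mul_eq_one_left (by rw [← sq, helem])
  refine ⟨fun g x y => by rw [hinv, hS], fun h m => ?_⟩
  obtain ⟨μ, c, hμ, hc⟩ := hU
  have hne : ∀ {a b : G}, a ≠ b → (σ a : Fin (d + 1)) ≠ σ b := fun hab h =>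
    hab (σ.injective (Subtype.ext h))
  have hμ1 : ∀ a b, a ≠ b → X.p (σ a) (σ a) (σ b) = μ := fun a b hab =>
    hμ _ _ (σ a).2 (σ b).2 (hne hab)
  have hμ2 : ∀ a b, a ≠ b → X.p (σ a) (σ b) (σ b) = μ := fun a b hab => by
    rw [hP.p_swap hS (σ a).2 (σ b).2, hμ1 b a hab.symm]
  have hμ3 : ∀ a b, a ≠ b → X.p (σ a) (σ b) (σ a) = μ := fun a b hab => by
    rw [X.p_comm, hμ2 b a hab.symm]
  -- The Kronecker delta is the contribution of the diagonal relation to the row sum.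
  have hrow : ∀ a b : G, (if a = b then 1 else 0) + ∑ g, X.p (σ g) (σ a) (σ b)
      = X.valency (σ a) := by
    intro a b
    rw [← hS.sum_p (σ a) (σ b), sum_index_eq σ, X.p_zero_left]
    simp [Subtype.ext_iff.symm]
  rw [hP _ (σ m) (σ _).2 (σ m).2]
  simp only [hinv]
  rw [← Nat.cast_sum]
  split_ifs with h1
  · subst h1
    rw [← hrow m m, if_pos rfl]
    push_cast
    rw [add_sub_cancel_left]
    refine Finset.sum_congr rfl fun g _ => ?_
    rw [mul_one]
    by_cases hg : g = m
    · rw [hg]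
    · rw [hμ1 g m hg, hμ2 g m hg]
  · have hhm : h * m ≠ m := by simpa using h1
    -- The comparison is with the row sum of `p g (hm) m`: on both sides the terms at g = m and g =
    -- hm are μ, all others c.
    rw [hP _ (σ (h * m)) (σ _).2 (σ _).2, ← hrow (h * m) m, if_neg hhm, zero_add, sub_zero]
    congr 1
    refine Finset.sum_congr rfl fun g _ => ?_
    have hsq : ∀ a b : G, a * b = m ↔ a = b * m := fun a b => by
      constructor
      · rintro rfl; rw [mul_left_comm, ← sq, helem, mul_one]
      · rintro rfl; rw [mul_right_comm, ← sq, helem, one_mul]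
    have hgh : g ≠ g * h := by simpa using h1
    by_cases hg : g = m
    · subst hg
      rw [hμ3 _ _ hgh, hμ3 _ _ hhm.symm]
    by_cases hg2 : g * h = m
    · have := (hsq g h).1 hg2
      rw [hg2, ← this, hμ2 g m hg, hμ1 g m hg]
    · have hg3 : g ≠ h * m := fun e => hg2 ((hsq g h).2 e)
      rw [hc _ _ _ (σ g).2 (σ _).2 (σ m).2 (hne hgh) (hne hg) (hne hg2),
        hc _ _ _ (σ g).2 (σ _).2 (σ m).2 (hne hg3) (hne hg) (hne hhm)]

end Labelled

end Uniform

end AssociationScheme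

/-! ### Two classes: equal multiplicities imply uniformity -/

lemma Matrix.rank_eq_trace_of_idempotent {ι : Type*} [Fintype ι] [DecidableEq ι]
    {E : Matrix ι ι ℂ} (h : E * E = E) : (E.rank : ℂ) = E.trace := by
  have hid : IsIdempotentElem (Matrix.toLin' E) := by
    rw [IsIdempotentElem, Module.End.mul_eq_comp, ← Matrix.toLin'_mul, h]
  rw [← Matrix.trace_toLin'_eq, (LinearMap.IsIdempotentElem.isProj_range _ hid).trace]
  rfl

namespace AssociationScheme

section TwoClasses

variable {Ω : Type*} [Fintype Ω]

lemma adj_apply {d : ℕ} (X : AssociationScheme Ω d) (i : Fin (d + 1)) (x y : Ω) :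
    X.adj i x y = if X.idx x y = i then 1 else 0 := by
  classical
  simp [adj, rel_iff_idx]

lemma adj_mem {d : ℕ} (X : AssociationScheme Ω d) (i : Fin (d + 1)) : X.adj i ∈ X.boseMesner :=
  Submodule.subset_span ⟨i, rfl⟩

variable [DecidableEq Ω]

lemma adj_zero {d : ℕ} (X : AssociationScheme Ω d) : X.adj 0 = 1 := by
  ext x y
  simp [adj_apply, idx_eq_zero, Matrix.one_apply]

/-- If `E` spans an ideal of the Bose-Mesner algebra, then the idempotent `E` is primitive. -/
lemma isPrimitiveIdempotent_of_scalar {d : ℕ} (X : AssociationScheme Ω d) {E : Matrix Ω Ω ℂ}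
    (hmem : E ∈ X.boseMesner) (hid : E * E = E) (hne : E ≠ 0)
    (hs : ∀ i, ∃ a : ℂ, E * X.adj i = a • E) : X.IsPrimitiveIdempotent E := by
  refine ⟨hmem, hid, hne, fun F hF hFF hEF => ?_⟩
  have hall : ∀ M ∈ X.boseMesner, ∃ a : ℂ, E * M = a • E := by
    intro M hM
    induction hM using Submodule.span_induction with
    | mem M h => obtain ⟨i, rfl⟩ := h; exact hs i
    | zero => exact ⟨0, by simp⟩
    | add M N _ _ h1 h2 =>
      obtain ⟨a, ha⟩ := h1
      obtain ⟨b, hb⟩ := h2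
      exact ⟨a + b, by rw [mul_add, ha, hb, add_smul]⟩
    | smul c M _ h1 =>
      obtain ⟨a, ha⟩ := h1
      exact ⟨c * a, by rw [Matrix.mul_smul, ha, smul_smul]⟩
  obtain ⟨a, ha⟩ := hall F hF
  rw [hEF] at ha
  have h2 : (a * a - a) • E = 0 := by
    have := hFF
    rw [ha, Matrix.smul_mul, Matrix.mul_smul, hid, smul_smul] at this
    rw [sub_smul, this, sub_self]
  rcases smul_eq_zero.1 h2 with h | h
  · rcases mul_eq_zero.1 (show a * (a - 1) = 0 by linear_combination h) with h | h
    · left; rw [ha, h, zero_smul]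
    · right; rw [ha, sub_eq_zero.1 h, one_smul]
  · exact (hne h).elim

/-- Here s and t are the eigenvalues of `adj 1` orthogonally to the all-ones vector, and E projects
onto the s-eigenspace there. Exchanging s and t gives the other idempotent. -/
lemma IsSymmetric.two_class_eigenspace {X : AssociationScheme Ω 2} (hS : X.IsSymmetric)
    (hP : X.IsPseudocyclic) {s t : ℂ} (hst : s ≠ t)
    (hadd : s + t = X.p 1 1 1 - X.p 1 1 2) (hmul : s * t = X.p 1 1 2 - X.valency 1) :
    ∃ E, X.IsPrimitiveIdempotent E ∧
      E ≠ (Fintype.card Ω : ℂ)⁻¹ • Matrix.of (fun _ _ => 1) ∧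
      (s - t) * E.trace = - (X.valency 1 * (1 + 2 * t)) := by
  set k : ℂ := (X.valency 1 : ℂ) with hk
  set A := X.adj 1 with hA
  set J : Matrix Ω Ω ℂ := Matrix.of (fun _ _ => 1) with hJ
  set n : ℂ := (Fintype.card Ω : ℂ) with hn
  have hval : ∀ i, i ≠ 0 → X.valency i = X.valency 1 := fun i hi => hP i 1 hi (by simp)
  have hnk : n = 1 + 2 * k := by
    rw [hn, hS.card_eq, Fin.sum_univ_three, hS.valency_zero, hval 2 (by simp)]
    push_cast
    ring
  have hn0 : n ≠ 0 := by
    obtain ⟨x, -, -⟩ := X.rel_nonempty 0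
    have : Nonempty Ω := ⟨x⟩
    rw [hn]
    exact Nat.cast_ne_zero.2 Fintype.card_ne_zero
  have hA2 : X.adj 2 = J - 1 - A := by
    ext x y
    rw [← X.adj_zero, Matrix.sub_apply, Matrix.sub_apply, hA, adj_apply, adj_apply, adj_apply]
    have : ∀ i : Fin 3, (if i = 2 then (1 : ℂ) else 0)
        = 1 - (if i = 0 then 1 else 0) - (if i = 1 then 1 else 0) := by
      intro i
      fin_cases i <;> simp
    exact this _
  have hJJ : J * J = n • J := by
    ext x y
    simp [Matrix.mul_apply, hJ, hn]
  have hAJ : A * J = k • J := by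
    ext x y
    simp only [Matrix.mul_apply, hA, hJ, adj_apply, Matrix.of_apply, mul_one, Matrix.smul_apply,
      smul_eq_mul]
    rw [hS.sum_idx_left (fun i => if i = 1 then (1 : ℂ) else 0)]
    simp [hk]
  have hJA : J * A = k • J := by
    ext x y
    simp only [Matrix.mul_apply, hA, hJ, adj_apply, Matrix.of_apply, one_mul, Matrix.smul_apply,
      smul_eq_mul, hS.idx_comm _ y]
    rw [hS.sum_idx_left (fun i => if i = 1 then (1 : ℂ) else 0)]
    simp [hk]
  have hAA : A * A = k • (1 : Matrix Ω Ω ℂ) + (X.p 1 1 1 : ℂ) • A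
      + (X.p 1 1 2 : ℂ) • (J - 1 - A) := by
    ext x y
    rw [← hA2, ← X.adj_zero]
    simp only [Matrix.mul_apply, Matrix.add_apply, Matrix.smul_apply, hA, adj_apply, smul_eq_mul]
    rw [X.sum_idx (fun i j => (if i = 1 then (1 : ℂ) else 0) * (if j = 1 then 1 else 0))]
    have h0 : X.p 1 1 0 = X.valency 1 := by rw [valency, hS.tr_eq]
    have : ∀ i : Fin 3, (X.p 1 1 i : ℂ) = k * (if i = 0 then 1 else 0)
        + X.p 1 1 1 * (if i = 1 then 1 else 0) + X.p 1 1 2 * (if i = 2 then 1 else 0) := by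
      intro i
      fin_cases i <;> simp [h0, hk]
    rw [← this]
    simp
  have hJE : J * (A - t • 1) * (1 - n⁻¹ • J) = 0 := by
    rw [mul_sub J, hJA, Matrix.mul_smul, mul_one, ← sub_smul, Matrix.smul_mul, mul_sub, mul_one,
      Matrix.mul_smul, hJJ, smul_smul, inv_mul_cancel₀ hn0, one_smul, sub_self, smul_zero]
  have hcomm : A * (1 - n⁻¹ • J) = (1 - n⁻¹ • J) * A := by
    rw [mul_sub, sub_mul, mul_one, one_mul, Matrix.mul_smul, Matrix.smul_mul, hAJ, hJA]
  have hJP : J * (1 - n⁻¹ • J) = 0 := by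
    rw [mul_sub, mul_one, Matrix.mul_smul, hJJ, smul_smul, inv_mul_cancel₀ hn0, one_smul, sub_self]
  have hPJ : (1 - n⁻¹ • J) * J = 0 := by
    rw [sub_mul, one_mul, Matrix.smul_mul, hJJ, smul_smul, inv_mul_cancel₀ hn0, one_smul, sub_self]
  set P : Matrix Ω Ω ℂ := 1 - n⁻¹ • J with hPdef
  have hPP : P * P = P := by
    conv_lhs => lhs; rw [hPdef]
    rw [sub_mul, one_mul, Matrix.smul_mul, hJP, smul_zero, sub_zero]
  -- That is, (A - s)(A - t) is a multiple of J, which P annihilates.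
  have hAAt : A * (A - t • 1) = s • (A - t • 1) + (X.p 1 1 2 : ℂ) • J := by
    rw [mul_sub, hAA, Matrix.mul_smul, mul_one]
    have e1 : (X.p 1 1 1 : ℂ) = s + t + X.p 1 1 2 := by rw [hadd]; ring
    have e2 : k = X.p 1 1 2 - s * t := by rw [hmul]; ring
    rw [e1, e2]
    module
  have hst' : s - t ≠ 0 := sub_ne_zero.2 hst
  set E : Matrix Ω Ω ℂ := (s - t)⁻¹ • ((A - t • 1) * P) with hE
  have hAE : A * E = s • E := by
    rw [hE, Matrix.mul_smul, ← mul_assoc, hAAt, add_mul, Matrix.smul_mul, Matrix.smul_mul, hJP,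
      smul_zero, add_zero, smul_comm]
  have hJE : J * E = 0 := by
    rw [hE, Matrix.mul_smul, ← mul_assoc, hJE, smul_zero]
  have hEJ : E * J = 0 := by
    rw [hE, Matrix.smul_mul, mul_assoc, hPJ, mul_zero, smul_zero]
  have hPE : P * E = E := by
    rw [hPdef, sub_mul, one_mul, Matrix.smul_mul, hJE, smul_zero, sub_zero]
  have hEA : E * A = s • E := by
    rw [← hAE, hE, Matrix.mul_smul, Matrix.smul_mul, mul_assoc, ← hcomm, ← mul_assoc, ← mul_assoc]
    congr 2
    rw [mul_sub, sub_mul, Matrix.mul_smul, Matrix.smul_mul, mul_one, one_mul]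
  have hEE : E * E = E := by
    conv_lhs => lhs; rw [hE]
    rw [Matrix.smul_mul, mul_assoc, hPE, sub_mul, hAE, Matrix.smul_mul, one_mul, ← sub_smul,
      smul_smul, inv_mul_cancel₀ hst', one_smul]
  have hexp : E = (s - t)⁻¹ • (A - t • 1 + (n⁻¹ * (t - k)) • J) := by
    rw [hE, hPdef, mul_sub, mul_one, Matrix.mul_smul, sub_mul, hAJ, Matrix.smul_mul, one_mul,
      ← sub_smul, smul_smul]
    congr 1
    rw [sub_eq_add_neg, ← neg_smul]
    congr 2
    ring
  have hmem1 : (1 : Matrix Ω Ω ℂ) ∈ X.boseMesner := X.adj_zero ▸ X.adj_mem 0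
  have hmemJ : J ∈ X.boseMesner := by
    have : J = X.adj 2 + 1 + A := by rw [hA2]; abel
    rw [this]
    exact add_mem (add_mem (X.adj_mem 2) hmem1) (X.adj_mem 1)
  have hmem : E ∈ X.boseMesner := by
    rw [hexp]
    exact Submodule.smul_mem _ _ (add_mem (sub_mem (X.adj_mem 1) (Submodule.smul_mem _ _ hmem1))
      (Submodule.smul_mem _ _ hmemJ))
  have hne : E ≠ 0 := by
    intro h0
    rw [hexp, smul_eq_zero, or_iff_right (inv_ne_zero hst')] at h0
    -- Entries of the bracket in `hexp` at pairs in relations 1 and 2 differ by 1, so they cannot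
    -- both vanish.
    have hval : ∀ i : Fin 3, (if i = 1 then (1 : ℂ) else 0) - t * (if i = 0 then 1 else 0)
        + n⁻¹ * (t - k) = 0 := by
      intro i
      obtain ⟨x, y, rfl⟩ := X.exists_idx i
      have := congrFun (congrFun h0 x) y
      rw [← X.adj_zero] at this
      simpa [hA, hJ, adj_apply] using this
    have h1 := hval 1
    have h2 := hval 2
    simp only [if_true, show (1 : Fin 3) ≠ 0 by decide, show (2 : Fin 3) ≠ 0 by decide,
      show (2 : Fin 3) ≠ 1 by decide, if_false] at h1 h2
    exact one_ne_zero (α := ℂ) (by linear_combination h1 - h2)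
  refine ⟨E, X.isPrimitiveIdempotent_of_scalar hmem hEE hne ?_, ?_, ?_⟩
  · intro i
    fin_cases i
    · exact ⟨1, by simp [X.adj_zero]⟩
    · exact ⟨s, hEA⟩
    · refine ⟨-1 - s, ?_⟩
      change E * X.adj 2 = _
      rw [hA2, mul_sub, mul_sub, hEJ, hEA, mul_one]
      module
  · intro h
    rw [h, Matrix.mul_smul, hJJ, smul_smul, inv_mul_cancel₀ hn0, one_smul] at hJE
    obtain ⟨x, -, -⟩ := X.rel_nonempty 0
    simpa [hJ] using congrFun (congrFun hJE x) x
  · have htA : A.trace = 0 := by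
      simp [Matrix.trace, hA, adj_apply, idx_self]
    have htJ : J.trace = n := by
      simp [Matrix.trace, hJ, hn]
    rw [hexp, Matrix.trace_smul, Matrix.trace_add, Matrix.trace_sub, Matrix.trace_smul,
      Matrix.trace_smul, htA, htJ, Matrix.trace_one, ← hn, smul_eq_mul, smul_eq_mul, smul_eq_mul,
      mul_inv_cancel_left₀ hst', mul_right_comm, inv_mul_cancel₀ hn0, hnk]
    ring

lemma IsSymmetric.isUniform_two {X : AssociationScheme Ω 2} (hS : X.IsSymmetric)
    (hP : X.IsPseudocyclic) (hM : X.HasEqualMultiplicities) : X.IsUniform := by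
  have h121 : X.p 2 1 1 = X.p 1 1 2 := hP.p_swap hS (by simp) (by simp) 1
  have hrow1 : 1 + X.p 1 1 1 + X.p 1 1 2 = X.valency 1 := by
    rw [← hS.sum_p 1 1, Fin.sum_univ_three, h121, X.p_zero_left, if_pos rfl]
  have hrow2 : X.p 1 1 2 + X.p 2 2 1 = X.valency 1 := by
    rw [hP 1 2 (by simp) (by simp), ← hS.sum_p 2 1, Fin.sum_univ_three, X.p_zero_left,
      if_neg (by decide), zero_add, X.p_comm 1 2, h121]
  obtain ⟨w, hw⟩ := IsAlgClosed.exists_pow_nat_eq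
    (((X.p 1 1 1 : ℂ) - X.p 1 1 2) ^ 2 + 4 * (X.valency 1 - X.p 1 1 2)) (n := 2) (by norm_num)
  -- The discriminant is a square plus 4(1 + `p 1 1 1`), hence positive; positivity is checked over
  -- the integers.
  have hw0 : w ≠ 0 := by
    rintro rfl
    rw [← hrow1] at hw
    have h : (((X.p 1 1 1 : ℤ) - X.p 1 1 2) ^ 2 + 4 * (1 + X.p 1 1 1) : ℤ) = 0 := by
      have : (((((X.p 1 1 1 : ℤ) - X.p 1 1 2) ^ 2 + 4 * (1 + X.p 1 1 1) : ℤ)) : ℂ) = 0 := by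
        push_cast at hw ⊢
        linear_combination -hw
      exact_mod_cast this
    have := sq_nonneg ((X.p 1 1 1 : ℤ) - X.p 1 1 2)
    omega
  set s : ℂ := ((X.p 1 1 1 : ℂ) - X.p 1 1 2 + w) / 2 with hs
  set t : ℂ := ((X.p 1 1 1 : ℂ) - X.p 1 1 2 - w) / 2 with ht
  have hsub : s - t = w := by rw [hs, ht]; ring
  have hadd : s + t = X.p 1 1 1 - X.p 1 1 2 := by rw [hs, ht]; ring
  have hmul : s * t = X.p 1 1 2 - X.valency 1 := by
    rw [hs, ht]; linear_combination (-1 / 4 : ℂ) * hw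
  have hst : s ≠ t := fun h => hw0 (by rw [← hsub, h, sub_self])
  obtain ⟨E, hE, hEJ, hEt⟩ := hS.two_class_eigenspace hP hst hadd hmul
  obtain ⟨F, hF, hFJ, hFt⟩ := hS.two_class_eigenspace hP hst.symm (add_comm s t ▸ hadd)
    (mul_comm s t ▸ hmul)
  have hrank := hM E F hE hF hEJ hFJ
  have htr : E.trace = F.trace := by
    rw [← Matrix.rank_eq_trace_of_idempotent hE.idem, ← Matrix.rank_eq_trace_of_idempotent hF.idem,
      hrank]
  rw [htr] at hEt
  have hk : (X.valency 1 : ℂ) ≠ 0 := Nat.cast_ne_zero.2 (hS.valency_pos 1).ne'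
  -- With equal traces, the left sides of the two trace formulas cancel on addition, so s + t = -1.
  have h1 : (X.valency 1 : ℂ) * (1 + (s + t)) = 0 := by
    linear_combination (1 / 2 : ℂ) * (hEt + hFt)
  have h2 := (mul_eq_zero.1 h1).resolve_left hk
  rw [hadd] at h2
  have h3 : X.p 1 1 1 + 1 = X.p 1 1 2 := by
    have : ((X.p 1 1 1 + 1 : ℕ) : ℂ) = (X.p 1 1 2 : ℕ) := by
      push_cast
      linear_combination h2
    exact_mod_cast this
  have h4 : X.p 2 2 1 = X.p 1 1 2 := by omega
  -- The value c = 0 is arbitrary: three distinct nonzero indices do not exist.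
  refine ⟨X.p 1 1 2, 0, ?_, ?_⟩
  · intro i j hi hj hij
    fin_cases i <;> fin_cases j <;> simp_all
  · intro i j l hi hj hl hij hil hjl
    exact absurd hjl (by omega)

end TwoClasses

/-! ### The candidate matrix, its square and the roux property -/

section Roux

variable {Ω G : Type*} [Fintype Ω] {d : ℕ}

lemma exists_labelled (X : AssociationScheme Ω d) (σ : Labelling G d) {x y : Ω} (h : x ≠ y) :
    ∃ g, X.idx x y = σ g :=
  ⟨σ.symm ⟨X.idx x y, fun h0 => h (X.idx_eq_zero.1 h0)⟩, by simp⟩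

variable [CommGroup G] [Fintype G]

lemma of_mul_sum (m : G) :
    (∑ g, MonoidAlgebra.of ℂ G g) * MonoidAlgebra.of ℂ G m = ∑ g, MonoidAlgebra.of ℂ G g := by
  rw [Finset.sum_mul]
  simp only [← map_mul]
  exact Equiv.sum_comp (Equiv.mulRight m) (fun g => MonoidAlgebra.of ℂ G g)

/-- The group ring element by which the candidate matrix encodes an index. -/
noncomputable def label (σ : Labelling G d) (i : Fin (d + 1)) : MonoidAlgebra ℂ G :=
  ∑ g, if (σ g : Fin (d + 1)) = i then MonoidAlgebra.of ℂ G g else 0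

lemma label_zero (σ : Labelling G d) : label σ 0 = 0 :=
  Finset.sum_eq_zero fun g _ => if_neg (σ g).2

variable [DecidableEq G]

lemma label_apply (σ : Labelling G d) (g : G) : label σ (σ g) = MonoidAlgebra.of ℂ G g := by
  simp [label, Subtype.ext_iff.symm]

lemma rouxCandidate_inl_inl (X : AssociationScheme Ω d) (σ : Labelling G d) (u v : Unit) :
    X.rouxCandidate σ (Sum.inl u) (Sum.inl v) = 0 := by
  rw [rouxCandidate, Matrix.sum_apply]
  refine Finset.sum_eq_zero fun g _ => ?_
  rw [Matrix.smul_apply, Matrix.map_apply, borderedAdj]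
  split_ifs <;> simp

lemma rouxCandidate_inl_inr (X : AssociationScheme Ω d) (σ : Labelling G d) (u : Unit) (x : Ω) :
    X.rouxCandidate σ (Sum.inl u) (Sum.inr x) = 1 := by
  rw [rouxCandidate, Matrix.sum_apply, Finset.sum_eq_single 1]
  · rw [Matrix.smul_apply, Matrix.map_apply, borderedAdj, if_pos rfl]
    simpa using MonoidAlgebra.one_def.symm
  · intro g _ hg
    rw [Matrix.smul_apply, Matrix.map_apply, borderedAdj, if_neg hg]
    simp
  · simp

lemma rouxCandidate_inr_inl (X : AssociationScheme Ω d) (σ : Labelling G d) (u : Unit) (x : Ω) :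
    X.rouxCandidate σ (Sum.inr x) (Sum.inl u) = 1 := by
  rw [rouxCandidate, Matrix.sum_apply, Finset.sum_eq_single 1]
  · rw [Matrix.smul_apply, Matrix.map_apply, borderedAdj, if_pos rfl]
    simpa using MonoidAlgebra.one_def.symm
  · intro g _ hg
    rw [Matrix.smul_apply, Matrix.map_apply, borderedAdj, if_neg hg]
    simp
  · simp

lemma rouxCandidate_inr_inr (X : AssociationScheme Ω d) (σ : Labelling G d) (x y : Ω) :
    X.rouxCandidate σ (Sum.inr x) (Sum.inr y) = label σ (X.idx x y) := by
  rw [rouxCandidate, Matrix.sum_apply, label]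
  refine Finset.sum_congr rfl fun g _ => ?_
  have : X.borderedAdj σ g (Sum.inr x) (Sum.inr y) = if X.idx x y = σ g then 1 else 0 := by
    classical
    rw [borderedAdj]
    split_ifs <;> simp_all [adj, rel_iff_idx]
  rw [Matrix.smul_apply, Matrix.map_apply, this]
  by_cases h : X.idx x y = σ g
  · simp [h]
  · simp [h, Ne.symm h]

variable [DecidableEq Ω]

/-- The quadratic equation of the candidate matrix. -/
lemma RouxConditions.rouxCandidate_sq {X : AssociationScheme Ω d} {σ : Labelling G d}
    (hR : X.RouxConditions σ) (hS : X.IsSymmetric) (hP : X.IsPseudocyclic)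
    (helem : ∀ g : G, g ^ 2 = 1) :
    X.rouxCandidate σ * X.rouxCandidate σ =
      (Fintype.card Ω : MonoidAlgebra ℂ G) • (1 : Matrix (Unit ⊕ Ω) (Unit ⊕ Ω) _) +
        ((X.valency (σ 1) : MonoidAlgebra ℂ G) * ∑ g, MonoidAlgebra.of ℂ G g) •
          X.rouxCandidate σ := by
  have hinv : ∀ g : G, g⁻¹ = g := fun g =>
    inv_eq_of_mul_eq_one_left (by rw [← sq, helem])
  have hrow : ∀ x, ∑ z, label σ (X.idx x z)
      = (X.valency (σ 1) : MonoidAlgebra ℂ G) * ∑ g, MonoidAlgebra.of ℂ G g := by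
    intro x
    rw [hS.sum_idx_left, sum_index_eq σ, label_zero, smul_zero, zero_add, Finset.mul_sum]
    refine Finset.sum_congr rfl fun g _ => ?_
    rw [label_apply, hP _ (σ 1) (σ g).2 (σ 1).2, nsmul_eq_mul]
  ext1 a b
  rw [Matrix.mul_apply, Fintype.sum_sum_type, Matrix.add_apply, Matrix.smul_apply,
    Matrix.smul_apply, Finset.univ_unique, Finset.sum_singleton]
  rcases a with u | x <;> rcases b with v | y
  · simp [rouxCandidate_inl_inl, rouxCandidate_inl_inr, rouxCandidate_inr_inl]
  · simp only [rouxCandidate_inl_inl, rouxCandidate_inl_inr, rouxCandidate_inr_inr, one_mul,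
      zero_mul, zero_add, hS.idx_comm _ y, hrow]
    simp
  · simp only [rouxCandidate_inl_inl, rouxCandidate_inr_inl, rouxCandidate_inr_inr, mul_one,
      mul_zero, zero_add, hrow]
    simp
  · simp only [rouxCandidate_inl_inr, rouxCandidate_inr_inl, rouxCandidate_inr_inr, mul_one]
    by_cases hxy : x = y
    · subst hxy
      simp only [X.idx_self, label_zero, Matrix.one_apply_eq, mul_zero, add_zero, smul_eq_mul,
        mul_one, hS.idx_comm _ x]
      rw [hS.sum_idx_left (fun i => label σ i * label σ i), hS.card_eq,
        sum_index_eq σ, sum_index_eq σ, label_zero, hS.valency_zero]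
      simp only [label_apply, ← map_pow, ← sq, helem, map_one]
      simp
    · obtain ⟨m, hm⟩ := X.exists_labelled σ hxy
      rw [X.sum_idx (fun i j => label σ i * label σ j), hm, label_apply, Matrix.one_apply_ne
        (by simpa using hxy), smul_zero, zero_add, smul_eq_mul, mul_assoc, of_mul_sum,
        sum_index_eq σ]
      simp only [sum_index_eq σ, label_zero, zero_mul, mul_zero, smul_zero, Finset.sum_const_zero,
        add_zero, zero_add, label_apply, ← map_mul]
      -- Substituting g' = gh turns the group element g g' into h, since g² = 1; the coefficient of
      -- h becomes the sum in (i).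
      have h1 : ∀ g, ∑ g', X.p (σ g) (σ g') (σ m) • MonoidAlgebra.of ℂ G (g * g')
          = ∑ h, X.p (σ g) (σ (g * h)) (σ m) • MonoidAlgebra.of ℂ G h := by
        intro g
        rw [← Equiv.sum_comp (Equiv.mulLeft g)]
        refine Finset.sum_congr rfl fun h _ => ?_
        rw [Equiv.coe_mulLeft, ← mul_assoc, ← sq, helem, one_mul]
      simp only [h1]
      rw [Finset.sum_comm]
      simp only [← Finset.sum_smul]
      have h2 : ∀ h, (∑ g, X.p (σ g) (σ (g * h)) (σ m)) + (if h = 1 then 1 else 0)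
          = X.valency (σ 1) := by
        intro h
        have := hR.intersection h m
        simp only [hinv] at this
        rw [hP _ (σ 1) (σ _).2 (σ 1).2] at this
        zify
        rw [this]
        split_ifs <;> simp
      -- The delta in (i) is exactly the summand 1 that the border row and column add to the entry
      -- of B².
      have h3 : ∀ h, (X.valency (σ 1) : MonoidAlgebra ℂ G) * MonoidAlgebra.of ℂ G h
          = (∑ g, X.p (σ g) (σ (g * h)) (σ m)) • MonoidAlgebra.of ℂ G h
            + if h = 1 then 1 else 0 := by
        intro h
        rw [← nsmul_eq_mul, ← h2 h, add_smul]
        congr 1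
        split_ifs with hh
        · rw [hh, one_smul, map_one]
        · rw [zero_smul]
      rw [Finset.mul_sum]
      simp only [h3, Finset.sum_add_distrib, Finset.sum_ite_eq', Finset.mem_univ, if_true]
      rw [add_comm]

lemma RouxConditions.isRouxMatrix {X : AssociationScheme Ω d} {σ : Labelling G d}
    (hR : X.RouxConditions σ) (hS : X.IsSymmetric) (hP : X.IsPseudocyclic)
    (helem : ∀ g : G, g ^ 2 = 1) : IsRouxMatrix (X.rouxCandidate σ) := by
  have hinv : ∀ g : G, g⁻¹ = g := fun g =>
    inv_eq_of_mul_eq_one_left (by rw [← sq, helem])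
  refine ⟨?_, ?_, ?_, ?_⟩
  · rintro (u | x)
    · exact rouxCandidate_inl_inl X σ u u
    · rw [rouxCandidate_inr_inr, idx_self, label_zero]
  · rintro (u | x) (v | y) h
    · exact (h rfl).elim
    · exact ⟨1, by rw [rouxCandidate_inl_inr, map_one]⟩
    · exact ⟨1, by rw [rouxCandidate_inr_inl, map_one]⟩
    · obtain ⟨g, hg⟩ := X.exists_labelled σ (x := x) (y := y) (by simpa using h)
      exact ⟨g, by rw [rouxCandidate_inr_inr, hg, label_apply]⟩
  · intro i j _ g hg
    rw [hinv, ← hg]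
    rcases i with u | x <;> rcases j with v | y
    · rfl
    · rw [rouxCandidate_inl_inr, rouxCandidate_inr_inl]
    · rw [rouxCandidate_inl_inr, rouxCandidate_inr_inl]
    · rw [rouxCandidate_inr_inr, rouxCandidate_inr_inr, hS.idx_comm]
  · set B := X.rouxCandidate σ with hB
    set S := Submodule.span ℂ
      (Set.range (fun g : G => MonoidAlgebra.of ℂ G g •
        (1 : Matrix (Unit ⊕ Ω) (Unit ⊕ Ω) (MonoidAlgebra ℂ G))) ∪
        Set.range (fun g : G => MonoidAlgebra.of ℂ G g • B)) with hSdef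
    have hI : ∀ g, MonoidAlgebra.of ℂ G g •
        (1 : Matrix (Unit ⊕ Ω) (Unit ⊕ Ω) (MonoidAlgebra ℂ G)) ∈ S := fun g =>
      Submodule.subset_span (Or.inl ⟨g, rfl⟩)
    have hBg : ∀ g, MonoidAlgebra.of ℂ G g • B ∈ S := fun g =>
      Submodule.subset_span (Or.inr ⟨g, rfl⟩)
    -- Multiplication by g fixes the sum of all group elements, so only natural multiples of g I and
    -- of the h B remain.
    have hsq : ∀ g, MonoidAlgebra.of ℂ G g • (B * B) ∈ S := by
      intro g
      rw [hR.rouxCandidate_sq hS hP helem, smul_add, smul_smul, smul_smul, mul_left_comm,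
        mul_comm _ (∑ g, _), of_mul_sum, mul_comm, ← nsmul_eq_mul, ← nsmul_eq_mul, smul_assoc,
        smul_assoc, Finset.sum_smul]
      exact add_mem (nsmul_mem (hI g) _) (nsmul_mem (sum_mem fun g _ => hBg g) _)
    refine ⟨S.toSubalgebra ?_ ?_, Submodule.toSubalgebra_toSubmodule _ _ _⟩
    · have h1 := hI 1
      rwa [map_one, one_smul] at h1
    · have hle : S * S ≤ S := by
        conv_lhs => rw [hSdef, Submodule.span_mul_span]
        rw [Submodule.span_le]
        rintro _ ⟨_, ⟨g, rfl⟩ | ⟨g, rfl⟩, _, ⟨h, rfl⟩ | ⟨h, rfl⟩, rfl⟩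
        all_goals
          simp only [smul_mul_assoc, mul_smul_comm, smul_smul, one_mul, mul_one, ← map_mul,
            SetLike.mem_coe]
        · exact hI _
        · exact hBg _
        · exact hBg _
        · exact hsq _
      exact fun x y hx hy => hle (Submodule.mul_mem_mul hx hy)

end Roux

end AssociationScheme

theorem mainTheorem10 {Ω G : Type*} [Fintype Ω] [DecidableEq Ω]
    [CommGroup G] [Fintype G] [DecidableEq G] (r : ℕ)
    (Y : AssociationScheme Ω r) (hamorphic : Y.IsAmorphic) (hpseudo : Y.IsPseudocyclic)
    (htwo : r = 2 → Y.HasEqualMultiplicities)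
    (helem : ∀ g : G, g ^ 2 = 1) (horder : Fintype.card G = r) :
    ∀ σ : AssociationScheme.Labelling G r,
      Y.RouxConditions σ ∧ IsRouxMatrix (Y.rouxCandidate σ) := by
  intro σ
  have hU : Y.IsUniform := by
    refine hamorphic.isUniform hpseudo fun h => ?_
    have hM := htwo h
    clear horder σ htwo
    subst h
    exact hamorphic.1.isUniform_two hpseudo hM
  have hR := hU.rouxConditions hamorphic.1 hpseudo helem σ
  exact ⟨hR, hR.isRouxMatrix hamorphic.1 hpseudo helem⟩
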